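/- Let $n\ge 2$, let $\mathbb S^n$ be the unit sphere of $\mathbb R^{n+1}$ with its Riemannian measure $d\eta$, let $e_{n+1}=(0,\dots,0,1)$, and let $\mathbb S^n_+=\{\xi\in\mathbb S^n:\xi_{n+1}\ge 0\}$. For a function $f$ on $\mathbb S^n$ and $\xi\in\mathbb S^n_+$ put $$(S_1f)(\xi)=\int_{\gamma_1(\xi)} f\,d_{\gamma_1}\eta,\qquad \gamma_1(\xi)=\{\eta\in\mathbb S^n:\ \eta_{n+1}<1,\ \xi\cdot\eta=\xi_{n+1}\},$$ where $d_{\gamma_1}\eta$ is the $(n-1)$-dimensional surface measure. For $x\in\mathbb R^n=e_{n+1}^\perp$ put $$(U_1f)(x)=\Big(\frac{4}{|x|^2+4}\Big)^{n-1} f\Big(\frac{4x+(|x|^2-4)e_{n+1}}{|x|^2+4}\Big).$$ Let $R$ be the hyperplane Radon transform of functions $g$ on $\mathbb R^n$, $(Rg)(\theta,t)=\int_{\theta^\perp} g(t\theta+u)\,d_\theta u$ for $\theta\in\mathbb S^{n-1}$, $t\in\mathbb R$, where $d_\theta u$ is the Euclidean measure on $\theta^\perp\subset\mathbb R^n$.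 For a function $\Phi$ on $\mathbb S^{n-1}\times\mathbb R$ and $\xi=\sqrt{1-s^2}\,\theta+s\,e_{n+1}$ with $\theta\in\mathbb S^{n-1}$, $0\le s<1$, put $$(V_1\Phi)(\xi)=\Phi\Big(\theta,\frac{2s}{\sqrt{1-s^2}}\Big).$$ Theorem. Let $f$ be a (real- or complex-valued) measurable function on $\mathbb S^n$ such that $$\int_{\mathbb S^n}\frac{|f(\eta)|}{\sqrt{1-\eta_{n+1}}}\,d\eta<\infty.$$ Then for almost all $\xi\in\mathbb S^n_+$ the integrals defining $(S_1f)(\xi)$ and $(V_1RU_1f)(\xi)$ exist in the Lebesgue sense (in particular $(S_1f)(\xi)$ is finite), and $$(S_1f)(\xi)=(V_1RU_1f)(\xi).$$ -/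

import Mathlib

open MeasureTheory

noncomputable section

namespace SphericalSlice

/-- The Euclidean space `ℝᵏ`. -/
abbrev E (k : ℕ) : Type := EuclideanSpace ℝ (Fin k)

/-- The unit sphere `𝕊ⁿ` of `ℝⁿ⁺¹`. Its Riemannian measure `dη` is the normalized `n`-dimensional
Hausdorff measure `μHE[n]` (the one that agrees with Lebesgue measure on `ℝⁿ`). -/
abbrev S (n : ℕ) : Type := Metric.sphere (0 : E (n + 1)) 1

/-- The last coordinate `η_{n+1}` of `η ∈ ℝⁿ⁺¹`. -/
def height {n : ℕ} (η : E (n + 1)) : ℝ := η (Fin.last n)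

/-- The first `n` coordinates `η' = (η₁, …, η_n)` of `η ∈ ℝⁿ⁺¹`. -/
def horiz {n : ℕ} (η : E (n + 1)) : E n := WithLp.toLp 2 fun i => η i.castSucc

/-- The closed upper hemisphere `{ξ ∈ 𝕊ⁿ : ξ_{n+1} ≥ 0}`. -/
def upper (n : ℕ) : Set (S n) := {ξ | 0 ≤ height (ξ : E (n + 1))}

/-- The slice through the north pole `e_{n+1}`, orthogonal to `ξ`, with the pole itself removed:
`{η ∈ 𝕊ⁿ : η_{n+1} < 1, ξ · η = ξ_{n+1}}`. -/
def slice {n : ℕ} (ξ : S n) : Set (S n) :=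
  {η | height (η : E (n + 1)) < 1 ∧
    inner ℝ (ξ : E (n + 1)) (η : E (n + 1)) = height (ξ : E (n + 1))}

/-- The spherical slice transform: the integral of `f` over the slice of `ξ` with respect to the
`(n - 1)`-dimensional surface measure. -/
def sliceTransform {n : ℕ} {𝕜 : Type*} [RCLike 𝕜] (f : S n → 𝕜) (ξ : S n) : 𝕜 :=
  ∫ η in slice ξ, f η ∂μHE[n - 1]

/-- The point `(4 x + (|x|² - 4) e_{n+1}) / (|x|² + 4)` of `ℝⁿ⁺¹`. -/
def stereoVec {n : ℕ} (x : E n) : E (n + 1) :=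
  WithLp.toLp 2 (Fin.snoc (α := fun _ => ℝ)
    (fun i => 4 * x i / (‖x‖ ^ 2 + 4)) ((‖x‖ ^ 2 - 4) / (‖x‖ ^ 2 + 4)))

lemma norm_stereoVec {n : ℕ} (x : E n) : ‖stereoVec x‖ = 1 := by
  have hpos : (0 : ℝ) < ‖x‖ ^ 2 + 4 := by positivity
  have hx : ∑ i, (x i) ^ 2 = ‖x‖ ^ 2 := by rw [EuclideanSpace.real_norm_sq_eq]
  have h : ‖stereoVec x‖ ^ 2 = 1 := by
    rw [EuclideanSpace.real_norm_sq_eq, Fin.sum_univ_castSucc]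
    simp only [stereoVec, Fin.snoc_castSucc, Fin.snoc_last]
    have : ∀ i : Fin n, (4 * x i / (‖x‖ ^ 2 + 4)) ^ 2
        = (16 / (‖x‖ ^ 2 + 4) ^ 2) * (x i) ^ 2 := fun i => by
      field_simp
      ring
    rw [Finset.sum_congr rfl fun i _ => this i, ← Finset.mul_sum, hx]
    field_simp
    ring
  have h0 : 0 ≤ ‖stereoVec x‖ := norm_nonneg _
  nlinarith

/-- The stereographic map `ℝⁿ → 𝕊ⁿ` from the north pole,
`x ↦ (4 x + (|x|² - 4) e_{n+1}) / (|x|² + 4)`. -/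
def stereo {n : ℕ} (x : E n) : S n := ⟨stereoVec x, by simp [norm_stereoVec]⟩

/-- `(U₁ f)(x) = (4 / (|x|² + 4)) ^ (n - 1) * f (stereo x)` for `x ∈ ℝⁿ`. -/
def U₁ {n : ℕ} {𝕜 : Type*} [RCLike 𝕜] (f : S n → 𝕜) (x : E n) : 𝕜 :=
  ((4 / (‖x‖ ^ 2 + 4)) ^ (n - 1) : ℝ) • f (stereo x)

/-- The hyperplane `θ^⊥` of `ℝⁿ`, as a set. -/
def perp {n : ℕ} (θ : E n) : Set (E n) := {u | inner ℝ θ u = 0}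

/-- The Radon transform `(R g)(θ, t)`: the integral of `u ↦ g (t θ + u)` over `θ^⊥` with respect to
the `(n - 1)`-dimensional Euclidean measure. It is used at unit vectors `θ`. -/
def radon {n : ℕ} {𝕜 : Type*} [RCLike 𝕜] (g : E n → 𝕜) (θ : E n) (t : ℝ) : 𝕜 :=
  ∫ u in perp θ, g (t • θ + u) ∂μHE[n - 1]

/-- The integral that defines `(R g)(θ, t)` exists in the Lebesgue sense. -/
def RadonExists {n : ℕ} {𝕜 : Type*} [RCLike 𝕜] (g : E n → 𝕜) (θ : E n) (t : ℝ) : Prop :=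
  IntegrableOn (fun u => g (t • θ + u)) (perp θ) μHE[n - 1]

/-- `(V₁ Φ)(ξ) = Φ (θ, 2 s / √(1 - s²))` for `ξ = √(1 - s²) θ + s e_{n+1}` with `θ` a unit vector of
`ℝⁿ` and `0 ≤ s < 1`; here `s = ξ_{n+1}` and `θ = ξ' / |ξ'|`, for `ξ` other than the pole. The
codomain `α` is arbitrary, so that this applies to statements about `(θ, t)` as well. -/
def V₁ {n : ℕ} {α : Sort*} (Φ : E n → ℝ → α) (ξ : S n) : α :=
  Φ (‖horiz (ξ : E (n + 1))‖⁻¹ • horiz (ξ : E (n + 1)))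
    (2 * height (ξ : E (n + 1)) / √(1 - height (ξ : E (n + 1)) ^ 2))

end SphericalSlice

end

/-! ### Hausdorff measure under maps with a two-point conformal identity -/

section ConformalHausdorff

open scoped NNReal ENNReal

variable {X Y : Type*} [MetricSpace X] [MeasurableSpace X] [BorelSpace X]
  [MetricSpace Y] [MeasurableSpace Y] [BorelSpace Y]

/-! Stereographic projection satisfies |σx - σy|² = ρ(x)ρ(y)|x - y|² with ρ = 4/(|x|² + 4). Such a
map changes `d`-dimensional Hausdorff measure by the density ρ^d, for every `d`
(`hausdorffMeasure_image_of_nndist_sq`). The slice of ξ is the image of the hyperplane ξ'·x =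
2ξ_{n+1}, so `d = n - 1` turns the slice integral into the Radon integral of `U₁ f`, for every ξ
with ξ' ≠ 0.

Existence is the almost-everywhere part. Since 1 - η_{n+1} = 8/(|x|² + 4), the case `d = n` turns
the hypothesis into integrability of |U₁ f| against (|x|² + 4)^(-1/2). Write non-vertical
hyperplanes as graphs u ↦ c - b·u. Those through x with |b|, |c| ≤ R form a set of b of measure
O((|x|² + 4)^(-1/2)), so Fubini gives integrability on almost every graph
(`ae_integrable_comp_graph`). Lipschitz charts (b, c) ↦ ±ξ carry the exceptional null set to a null
set of the sphere, and the normals of vertical hyperplanes are null as well (`ae_sliceHyperplane`).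
-/

lemma hausdorffMeasure_image_le_of_nndist_sq {φ : X → Y} {ρ : X → ℝ≥0}
    (hφ : ∀ x y, nndist (φ x) (φ y) ^ 2 = ρ x * ρ y * nndist x y ^ 2)
    (d : ℕ) {A : Set X} {b : ℝ≥0} (hb : ∀ x ∈ A, ρ x ≤ b) :
    μH[(d : ℝ)] (φ '' A) ≤ (b : ℝ≥0∞) ^ d * μH[(d : ℝ)] A := by
  have h : LipschitzOnWith b φ A := by
    rw [lipschitzOnWith_iff_dist_le_mul]
    intro x hx y hy
    have h1 : nndist (φ x) (φ y) ^ 2 ≤ (b * nndist x y) ^ 2 := by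
      rw [hφ, mul_pow, sq b]
      gcongr
      exacts [hb x hx, hb y hy]
    exact_mod_cast (pow_le_pow_iff_left₀ zero_le zero_le two_ne_zero).1 h1
  simpa [ENNReal.rpow_natCast] using h.hausdorffMeasure_image_le (d := d) (by positivity)

/-- On `A` the map expands distances by at least `a`, so it is injective there and its inverse is
`a⁻¹`-Lipschitz. -/
lemma hausdorffMeasure_le_image_of_nndist_sq {φ : X → Y} {ρ : X → ℝ≥0}
    (hφ : ∀ x y, nndist (φ x) (φ y) ^ 2 = ρ x * ρ y * nndist x y ^ 2)
    (d : ℕ) {A : Set X} {a : ℝ≥0} (ha0 : 0 < a) (ha : ∀ x ∈ A, a ≤ ρ x) :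
    (a : ℝ≥0∞) ^ d * μH[(d : ℝ)] A ≤ μH[(d : ℝ)] (φ '' A) := by
  have key : ∀ x ∈ A, ∀ y ∈ A, a * nndist x y ≤ nndist (φ x) (φ y) := by
    intro x hx y hy
    have h1 : (a * nndist x y) ^ 2 ≤ nndist (φ x) (φ y) ^ 2 := by
      rw [hφ, mul_pow, sq a]
      gcongr
      exacts [ha x hx, ha y hy]
    exact (pow_le_pow_iff_left₀ zero_le zero_le two_ne_zero).1 h1
  have hinj : Set.InjOn φ A := by
    intro x hx y hy hxy
    have := key x hx y hy
    rw [hxy, nndist_self, nonpos_iff_eq_zero, mul_eq_zero] at this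
    exact nndist_eq_zero.1 (this.resolve_left ha0.ne')
  rcases A.eq_empty_or_nonempty with rfl | ⟨x0, hx0⟩
  · simp
  have : Nonempty X := ⟨x0⟩
  have hl : Set.LeftInvOn (Function.invFunOn φ A) φ A := hinj.leftInvOn_invFunOn
  have hlip : LipschitzOnWith a⁻¹ (Function.invFunOn φ A) (φ '' A) := by
    rw [lipschitzOnWith_iff_dist_le_mul]
    rintro _ ⟨x, hx, rfl⟩ _ ⟨y, hy, rfl⟩
    rw [hl hx, hl hy]
    have h1 : nndist x y ≤ a⁻¹ * nndist (φ x) (φ y) := by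
      rw [← div_eq_inv_mul, le_div_iff₀ ha0, mul_comm]
      exact key x hx y hy
    exact_mod_cast h1
  have h := hlip.hausdorffMeasure_image_le (d := d) (by positivity)
  rw [hl.image_image, ENNReal.rpow_natCast, ENNReal.coe_inv ha0.ne'] at h
  calc (a : ℝ≥0∞) ^ d * μH[(d : ℝ)] A
      ≤ (a : ℝ≥0∞) ^ d * ((a : ℝ≥0∞)⁻¹ ^ d * μH[(d : ℝ)] (φ '' A)) := by gcongr
    _ = μH[(d : ℝ)] (φ '' A) := by
      rw [← mul_assoc, ← mul_pow, ENNReal.mul_inv_cancel (by simpa using ha0.ne') (by simp),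
        one_pow, one_mul]

/-- The shells q^k ≤ ρ < q^(k+1) partition the space, because ρ avoids 0 and ∞. -/
lemma measure_le_mul_of_forall_Ico_zpow {X : Type*} [MeasurableSpace X] {ν κ : Measure X} {ρ : X → ℝ≥0∞} (hρ : Measurable ρ)
    (h0 : ∀ x, ρ x ≠ 0) (htop : ∀ x, ρ x ≠ ∞) {q : ℝ≥0} (hq : 1 < q) (C : ℝ≥0∞)
    (h : ∀ (k : ℤ) (B : Set X), MeasurableSet B →
      B ⊆ ρ ⁻¹' Set.Ico ((q : ℝ≥0∞) ^ k) ((q : ℝ≥0∞) ^ (k + 1)) → ν B ≤ C * κ B)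
    {A : Set X} (hA : MeasurableSet A) : ν A ≤ C * κ A := by
  have e0 : ρ ⁻¹' {0} = ∅ := by ext x; simpa using h0 x
  have e1 : ρ ⁻¹' {∞} = ∅ := by ext x; simpa using htop x
  rw [measure_eq_measure_preimage_add_measure_tsum_Ico_zpow ν hρ hA hq,
    measure_eq_measure_preimage_add_measure_tsum_Ico_zpow κ hρ hA hq, e0, e1]
  simp only [Set.inter_empty, measure_empty, zero_add]
  rw [← ENNReal.tsum_mul_left]
  exact ENNReal.tsum_le_tsum fun k =>
    h k _ (hA.inter (hρ measurableSet_Ico)) Set.inter_subset_right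

lemma ENNReal.le_of_forall_one_lt_pow_mul {x y : ℝ≥0∞} (d : ℕ)
    (h : ∀ q : ℝ≥0, 1 < q → x ≤ (q : ℝ≥0∞) ^ d * y) : x ≤ y := by
  rcases eq_or_ne y ∞ with rfl | hy
  · simp
  have hc : Filter.Tendsto (fun q : ℝ≥0 => (q : ℝ≥0∞) ^ d * y) (nhdsWithin 1 (Set.Ioi 1))
      (nhds ((1 : ℝ≥0∞) ^ d * y)) := by
    refine ENNReal.Tendsto.mul_const ?_ (Or.inr hy)
    refine ((ENNReal.continuous_pow d).tendsto _).comp ?_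
    exact (ENNReal.tendsto_coe.2 Filter.tendsto_id).mono_left nhdsWithin_le_nhds
  have : (nhdsWithin (1 : ℝ≥0) (Set.Ioi 1)).NeBot := inferInstance
  simpa using ge_of_tendsto hc (Filter.eventually_of_mem self_mem_nhdsWithin fun q hq => h q hq)

/-- A map with `dist (φ x) (φ y) ^ 2 = ρ x * ρ y * dist x y ^ 2` transforms the `d`-dimensional
Hausdorff measure with density `ρ ^ d`. -/
theorem hausdorffMeasure_image_of_nndist_sq {φ : X → Y} {ρ : X → ℝ≥0} (hρ : Measurable ρ)
    (hρ0 : ∀ x, ρ x ≠ 0) (hφm : MeasurableEmbedding φ)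
    (hφ : ∀ x y, nndist (φ x) (φ y) ^ 2 = ρ x * ρ y * nndist x y ^ 2)
    (d : ℕ) {A : Set X} (hA : MeasurableSet A) :
    μH[(d : ℝ)] (φ '' A) = ∫⁻ x in A, (ρ x : ℝ≥0∞) ^ d ∂μH[(d : ℝ)] := by
  set κ : Measure X := μH[(d : ℝ)].withDensity fun x => (ρ x : ℝ≥0∞) ^ d with hκ
  set ν : Measure X := (μH[(d : ℝ)] : Measure Y).comap φ with hν
  have hνA : ∀ B, MeasurableSet B → ν B = μH[(d : ℝ)] (φ '' B) := fun B hB =>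
    hφm.comap_apply _ _
  have hκA : ∀ B, MeasurableSet B → κ B = ∫⁻ x in B, (ρ x : ℝ≥0∞) ^ d ∂μH[(d : ℝ)] := fun B hB =>
    withDensity_apply _ hB
  have hρ' : Measurable fun x => (ρ x : ℝ≥0∞) := hρ.coe_nnreal_ennreal
  -- On a shell both measures lie between q^(kd) and q^((k+1)d) times `μH[d]`, so they agree up to
  -- the factor q^d. Letting q → 1 at the end gives equality.
  have bounds : ∀ q : ℝ≥0, 1 < q → ∀ (k : ℤ) (B : Set X), MeasurableSet B →
      B ⊆ (fun x => (ρ x : ℝ≥0∞)) ⁻¹' Set.Ico ((q : ℝ≥0∞) ^ k) ((q : ℝ≥0∞) ^ (k + 1)) →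
      ν B ≤ (q : ℝ≥0∞) ^ d * κ B ∧ κ B ≤ (q : ℝ≥0∞) ^ d * ν B := by
    intro q hq k B hB hsub
    have hq0 : q ≠ 0 := (zero_lt_one.trans hq).ne'
    have hcoe : ∀ j : ℤ, (q : ℝ≥0∞) ^ j = ((q ^ j : ℝ≥0) : ℝ≥0∞) := fun j =>
      (ENNReal.coe_zpow hq0 j).symm
    have hlo : ∀ x ∈ B, q ^ k ≤ ρ x := fun x hx => by
      have := (hsub hx).1
      rw [hcoe] at this
      exact ENNReal.coe_le_coe.1 this
    have hhi : ∀ x ∈ B, ρ x ≤ q ^ (k + 1) := fun x hx => by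
      have := (hsub hx).2.le
      rw [hcoe] at this
      exact ENNReal.coe_le_coe.1 this
    have hsplit : ((q ^ (k + 1) : ℝ≥0) : ℝ≥0∞) ^ d
        = (q : ℝ≥0∞) ^ d * ((q ^ k : ℝ≥0) : ℝ≥0∞) ^ d := by
      rw [zpow_add_one₀ hq0, ENNReal.coe_mul, mul_pow, mul_comm]
    rw [hνA B hB, hκA B hB]
    constructor
    · calc μH[(d : ℝ)] (φ '' B) ≤ ((q ^ (k + 1) : ℝ≥0) : ℝ≥0∞) ^ d * μH[(d : ℝ)] B :=
            hausdorffMeasure_image_le_of_nndist_sq hφ d hhi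
        _ = (q : ℝ≥0∞) ^ d * ∫⁻ _ in B, ((q ^ k : ℝ≥0) : ℝ≥0∞) ^ d ∂μH[(d : ℝ)] := by
            rw [hsplit, setLIntegral_const, mul_assoc]
        _ ≤ _ := by
            gcongr _ * ?_
            refine setLIntegral_mono (hρ'.pow_const d) fun x hx => ?_
            gcongr
            exact hlo x hx
    · calc ∫⁻ x in B, (ρ x : ℝ≥0∞) ^ d ∂μH[(d : ℝ)]
          ≤ ∫⁻ _ in B, ((q ^ (k + 1) : ℝ≥0) : ℝ≥0∞) ^ d ∂μH[(d : ℝ)] := by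
            refine setLIntegral_mono measurable_const fun x hx => ?_
            gcongr
            exact hhi x hx
        _ = (q : ℝ≥0∞) ^ d * (((q ^ k : ℝ≥0) : ℝ≥0∞) ^ d * μH[(d : ℝ)] B) := by
            rw [hsplit, setLIntegral_const, mul_assoc]
        _ ≤ _ := by
            gcongr
            exact hausdorffMeasure_le_image_of_nndist_sq hφ d (by positivity) hlo
  rw [← hνA A hA, ← hκA A hA]
  have hne : ∀ x, (ρ x : ℝ≥0∞) ≠ 0 := fun x => by simpa using hρ0 x
  apply le_antisymm
  · exact ENNReal.le_of_forall_one_lt_pow_mul d fun q hq =>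
      measure_le_mul_of_forall_Ico_zpow hρ' hne (by simp) hq _
        (fun k B hB h => (bounds q hq k B hB h).1) hA
  · exact ENNReal.le_of_forall_one_lt_pow_mul d fun q hq =>
      measure_le_mul_of_forall_Ico_zpow hρ' hne (by simp) hq _
        (fun k B hB h => (bounds q hq k B hB h).2) hA

/-- The restriction of `μHE[d]` to the image of a set under a conformal map is the push-forward of
a measure with density. -/
theorem euclideanHausdorffMeasure_restrict_image_of_nndist_sq {φ : X → Y} {ρ : X → ℝ≥0}
    (hρ : Measurable ρ) (hρ0 : ∀ x, ρ x ≠ 0) (hφm : MeasurableEmbedding φ)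
    (hφ : ∀ x y, nndist (φ x) (φ y) ^ 2 = ρ x * ρ y * nndist x y ^ 2)
    (d : ℕ) {A : Set X} (hA : MeasurableSet A) :
    (μHE[d] : Measure Y).restrict (φ '' A)
      = (((μHE[d] : Measure X).restrict A).withDensity
          fun x => ((ρ x ^ d : ℝ≥0) : ℝ≥0∞)).map φ := by
  have hm : Measurable fun x => ((ρ x ^ d : ℝ≥0) : ℝ≥0∞) := (hρ.pow_const d).coe_nnreal_ennreal
  ext T hT
  have hTA : MeasurableSet (φ ⁻¹' T) := hφm.measurable hT
  -- `μHE[d]` is `μH[d]` times a constant depending only on `d`, hence the same constant on `X` and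
  -- `Y`.
  rw [Measure.restrict_apply hT, hφm.map_apply, withDensity_apply _ hTA,
    Measure.restrict_restrict hTA, Measure.euclideanHausdorffMeasure_def,
    Measure.euclideanHausdorffMeasure_def, Measure.smul_apply, Measure.restrict_smul,
    lintegral_smul_measure, ← Set.image_preimage_inter,
    hausdorffMeasure_image_of_nndist_sq hρ hρ0 hφm hφ d (hTA.inter hA)]
  simp

end ConformalHausdorff

noncomputable section

namespace SphericalSlice

open scoped NNReal ENNReal

/-! ### Splitting off the last coordinate -/

section Join

variable {m : ℕ}

/-- The point `(u, t)` of `ℝᵐ⁺¹`. -/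
def join (p : E m × ℝ) : E (m + 1) :=
  WithLp.toLp 2 (Fin.snoc (α := fun _ => ℝ) (fun i => p.1 i) p.2)

@[simp] lemma horiz_join (p : E m × ℝ) : horiz (join p) = p.1 := by
  ext i
  simp [horiz, join]

@[simp] lemma height_join (p : E m × ℝ) : height (join p) = p.2 := by
  simp [height, join]

@[simp] lemma join_horiz_height (x : E (m + 1)) : join (horiz x, height x) = x := by
  ext i
  refine Fin.lastCases ?_ (fun j => ?_) i <;> simp [join, horiz, height]

lemma inner_eq_horiz_height (x y : E (m + 1)) :
    inner ℝ x y = inner ℝ (horiz x) (horiz y) + height x * height y := by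
  simp [PiLp.inner_apply, Fin.sum_univ_castSucc, horiz, height, mul_comm]

lemma norm_sq_eq_horiz_height (x : E (m + 1)) : ‖x‖ ^ 2 = ‖horiz x‖ ^ 2 + height x ^ 2 := by
  rw [← real_inner_self_eq_norm_sq, ← real_inner_self_eq_norm_sq, inner_eq_horiz_height, sq (height x)]

lemma norm_join_sq (p : E m × ℝ) : ‖join p‖ ^ 2 = ‖p.1‖ ^ 2 + p.2 ^ 2 := by
  simp [norm_sq_eq_horiz_height]

lemma join_sub (p q : E m × ℝ) : join p - join q = join (p - q) := by
  ext i
  refine Fin.lastCases ?_ (fun j => ?_) i <;> simp [join]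

lemma join_smul (c : ℝ) (p : E m × ℝ) : join (c • p) = c • join p := by
  ext i
  refine Fin.lastCases ?_ (fun j => ?_) i <;> simp [join]

lemma continuous_horiz : Continuous (horiz : E (m + 1) → E m) := by
  unfold horiz
  fun_prop

lemma continuous_height : Continuous (height : E (m + 1) → ℝ) := by
  unfold height
  fun_prop

lemma norm_join_le (p : E m × ℝ) : ‖join p‖ ≤ 2 * ‖p‖ := by
  have h1 := norm_fst_le p
  have h2 := norm_snd_le p
  rw [Real.norm_eq_abs] at h2
  refine abs_le_of_sq_le_sq' ?_ (by positivity) |>.2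
  rw [norm_join_sq]
  nlinarith [norm_nonneg p.1, abs_nonneg p.2, sq_abs p.2, norm_nonneg p]

lemma lipschitzWith_join : LipschitzWith 2 (join : E m × ℝ → E (m + 1)) :=
  LipschitzWith.of_dist_le_mul fun p q => by
    rw [dist_eq_norm, dist_eq_norm, join_sub]
    exact norm_join_le _

lemma measurePreserving_join :
    MeasurePreserving (join : E m × ℝ → E (m + 1)) volume volume := by
  have h1 : MeasurePreserving (fun p : E m × ℝ => ((WithLp.ofLp p.1 : Fin m → ℝ), p.2))
      volume volume :=
    (PiLp.volume_preserving_ofLp (Fin m)).prod (MeasurePreserving.id volume)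
  have h2 : MeasurePreserving (Prod.swap : (Fin m → ℝ) × ℝ → ℝ × (Fin m → ℝ)) volume volume :=
    Measure.measurePreserving_swap
  have h3 := (volume_preserving_piFinSuccAbove (fun _ : Fin (m + 1) => ℝ) (Fin.last m)).symm
  have h4 := PiLp.volume_preserving_toLp (Fin (m + 1))
  have e : (join : E m × ℝ → E (m + 1)) = WithLp.toLp 2 ∘
      (MeasurableEquiv.piFinSuccAbove (fun _ : Fin (m + 1) => ℝ) (Fin.last m)).symm ∘
      Prod.swap ∘ fun p => (WithLp.ofLp p.1, p.2) := by
    funext p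
    simp [join, Fin.insertNth_last', MeasurableEquiv.piFinSuccAbove, Fin.insertNthEquiv]
  rw [e]
  exact h4.comp (h3.comp (h2.comp h1))

lemma volume_setOf_height_eq_zero : volume {x : E (m + 1) | height x = 0} = 0 := by
  rw [← measurePreserving_join.measure_preimage
    (isClosed_eq continuous_height continuous_const).measurableSet.nullMeasurableSet]
  have : (join : E m × ℝ → E (m + 1)) ⁻¹' {x | height x = 0} = Set.univ ×ˢ {0} := by
    ext p; simp
  rw [this, Measure.volume_eq_prod, Measure.prod_prod]
  simp

end Join

/-! ### Stereographic projection, slices and hyperplanes -/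

section Stereo

variable {n : ℕ}

lemma stereoVec_eq_join (x : E n) :
    stereoVec x = join ((4 / (‖x‖ ^ 2 + 4)) • x, (‖x‖ ^ 2 - 4) / (‖x‖ ^ 2 + 4)) := by
  ext i
  refine Fin.lastCases ?_ (fun j => ?_) i
  · simp [stereoVec, join]
  · simp only [stereoVec, join, Fin.snoc_castSucc, PiLp.smul_apply, smul_eq_mul]
    ring

lemma horiz_stereo (x : E n) :
    horiz (stereo x : E (n + 1)) = (4 / (‖x‖ ^ 2 + 4)) • x := by
  simp [stereo, stereoVec_eq_join]

lemma height_stereo (x : E n) :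
    height (stereo x : E (n + 1)) = (‖x‖ ^ 2 - 4) / (‖x‖ ^ 2 + 4) := by
  simp [stereo, stereoVec_eq_join]

lemma one_sub_height_stereo (x : E n) :
    1 - height (stereo x : E (n + 1)) = 8 / (‖x‖ ^ 2 + 4) := by
  rw [height_stereo]
  field_simp
  ring

lemma norm_horiz_sq_add_height_sq (ξ : S n) :
    ‖horiz (ξ : E (n + 1))‖ ^ 2 + height (ξ : E (n + 1)) ^ 2 = 1 := by
  rw [← norm_sq_eq_horiz_height, norm_eq_of_mem_sphere, one_pow]

/-- The ray from the north pole through η meets the tangent plane at the south pole above 2η'/(1 -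
η_{n+1}). -/
lemma stereo_surjOn {η : S n} (hη : height (η : E (n + 1)) < 1) :
    stereo ((2 / (1 - height (η : E (n + 1)))) • horiz (η : E (n + 1))) = η := by
  set h := height (η : E (n + 1)) with hh
  have h1 : 0 < 1 - h := by linarith
  have hn := norm_horiz_sq_add_height_sq η
  have hx : ‖(2 / (1 - h)) • horiz (η : E (n + 1))‖ ^ 2 + 4 = 8 / (1 - h) := by
    rw [norm_smul, mul_pow, Real.norm_eq_abs, sq_abs, eq_sub_of_add_eq hn, ← hh]
    field_simp
    ring
  apply Subtype.ext
  refine (join_horiz_height _).symm.trans (Eq.trans ?_ (join_horiz_height (η : E (n + 1))))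
  congr 2
  · rw [horiz_stereo, hx, smul_smul]
    have : 4 / (8 / (1 - h)) * (2 / (1 - h)) = 1 := by field_simp; norm_num
    rw [this, one_smul]
  · have := one_sub_height_stereo ((2 / (1 - h)) • horiz (η : E (n + 1)))
    rw [hx] at this
    have h8 : 8 / (8 / (1 - h)) = 1 - h := by field_simp
    rw [h8] at this
    linarith

lemma height_stereo_lt_one (x : E n) : height (stereo x : E (n + 1)) < 1 := by
  have := one_sub_height_stereo x
  have h : (0 : ℝ) < 8 / (‖x‖ ^ 2 + 4) := by positivity
  linarith

/-- The conformal factor of the stereographic map. -/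
def conformalFactor (x : E n) : ℝ≥0 := 4 / (‖x‖₊ ^ 2 + 4)

lemma coe_conformalFactor (x : E n) : (conformalFactor x : ℝ) = 4 / (‖x‖ ^ 2 + 4) := by
  simp [conformalFactor]

lemma conformalFactor_ne_zero (x : E n) : conformalFactor x ≠ 0 := by
  unfold conformalFactor
  positivity

lemma measurable_conformalFactor : Measurable (conformalFactor : E n → ℝ≥0) := by
  unfold conformalFactor
  fun_prop

lemma nndist_stereo_sq (x y : E n) :
    nndist (stereo x) (stereo y) ^ 2
      = conformalFactor x * conformalFactor y * nndist x y ^ 2 := by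
  have hn : ∀ z : E n, ‖(stereo z : E (n + 1))‖ = 1 := fun z => norm_eq_of_mem_sphere _
  apply NNReal.coe_injective
  push_cast
  rw [coe_conformalFactor, coe_conformalFactor, Subtype.dist_eq, dist_eq_norm, dist_eq_norm,
    norm_sub_sq_real, norm_sub_sq_real, hn, hn, inner_eq_horiz_height, horiz_stereo, horiz_stereo,
    height_stereo, height_stereo, real_inner_smul_left, real_inner_smul_right]
  field_simp
  ring

lemma lipschitzWith_stereo : LipschitzWith 1 (stereo : E n → S n) := by
  refine LipschitzWith.of_dist_le_mul fun x y => ?_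
  have hle : ∀ z : E n, conformalFactor z ≤ 1 := fun z => by
    rw [conformalFactor, div_le_one (by positivity)]
    exact le_add_of_nonneg_left (by positivity)
  have h : nndist (stereo x) (stereo y) ^ 2 ≤ (1 * nndist x y) ^ 2 := by
    rw [nndist_stereo_sq, one_mul]
    exact mul_le_of_le_one_left (by positivity) (mul_le_one' (hle x) (hle y))
  exact_mod_cast (pow_le_pow_iff_left₀ zero_le zero_le two_ne_zero).1 h

lemma stereo_injective : Function.Injective (stereo : E n → S n) := by
  intro x y h
  have := nndist_stereo_sq x y
  rw [h, nndist_self] at this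
  simpa [conformalFactor_ne_zero] using this.symm

lemma measurableEmbedding_stereo : MeasurableEmbedding (stereo : E n → S n) :=
  lipschitzWith_stereo.continuous.measurableEmbedding stereo_injective

lemma euclideanHausdorffMeasure_restrict_image_stereo (d : ℕ) {A : Set (E n)}
    (hA : MeasurableSet A) :
    (μHE[d] : Measure (S n)).restrict (stereo '' A)
      = (((μHE[d] : Measure (E n)).restrict A).withDensity
          fun x => ((conformalFactor x ^ d : ℝ≥0) : ℝ≥0∞)).map stereo :=
  euclideanHausdorffMeasure_restrict_image_of_nndist_sq measurable_conformalFactor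
    conformalFactor_ne_zero measurableEmbedding_stereo nndist_stereo_sq d hA

variable {𝕜 : Type*} [RCLike 𝕜]

lemma integrableOn_image_stereo_iff (d : ℕ) {A : Set (E n)} (hA : MeasurableSet A) (f : S n → 𝕜) :
    IntegrableOn f (stereo '' A) μHE[d]
      ↔ IntegrableOn (fun x => ((4 / (‖x‖ ^ 2 + 4)) ^ d : ℝ) • f (stereo x)) A μHE[d] := by
  rw [IntegrableOn, euclideanHausdorffMeasure_restrict_image_stereo d hA,
    measurableEmbedding_stereo.integrable_map_iff,
    integrable_withDensity_iff_integrable_smul (measurable_conformalFactor.pow_const d)]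
  simp only [NNReal.smul_def, NNReal.coe_pow, coe_conformalFactor, Function.comp_apply]
  rfl

lemma setIntegral_image_stereo (d : ℕ) {A : Set (E n)} (hA : MeasurableSet A) (f : S n → 𝕜) :
    ∫ η in stereo '' A, f η ∂μHE[d]
      = ∫ x in A, ((4 / (‖x‖ ^ 2 + 4)) ^ d : ℝ) • f (stereo x) ∂μHE[d] := by
  rw [euclideanHausdorffMeasure_restrict_image_stereo d hA,
    measurableEmbedding_stereo.integral_map,
    integral_withDensity_eq_integral_smul (measurable_conformalFactor.pow_const d)]
  simp only [NNReal.smul_def, NNReal.coe_pow, coe_conformalFactor]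

/-- The hyperplane of `ℝⁿ` that the stereographic map sends to the slice of `ξ`. -/
def sliceHyperplane (ξ : S n) : Set (E n) :=
  {x | inner ℝ (horiz (ξ : E (n + 1))) x = 2 * height (ξ : E (n + 1))}

lemma measurableSet_sliceHyperplane (ξ : S n) : MeasurableSet (sliceHyperplane ξ) :=
  (isClosed_eq (by fun_prop) continuous_const).measurableSet

/-- After clearing denominators in ξ·σx = ξ_{n+1}, the |x|² terms cancel and a linear equation
remains. -/
lemma slice_eq_image_stereo (ξ : S n) : slice ξ = stereo '' sliceHyperplane ξ := by
  have key : ∀ x : E n, inner ℝ (ξ : E (n + 1)) (stereo x : E (n + 1)) = height (ξ : E (n + 1))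
      ↔ x ∈ sliceHyperplane ξ := fun x => by
    rw [inner_eq_horiz_height, horiz_stereo, height_stereo, real_inner_smul_right, sliceHyperplane,
      Set.mem_ofPred_eq]
    field_simp
    constructor <;> intro h <;> linarith
  ext η
  constructor
  · rintro ⟨h1, h2⟩
    rw [← stereo_surjOn h1] at h2 ⊢
    exact Set.mem_image_of_mem _ ((key _).1 h2)
  · rintro ⟨x, hx, rfl⟩
    exact ⟨height_stereo_lt_one x, (key x).2 hx⟩

/-- As |ξ'| = √(1 - s²), the hyperplane has unit normal θ = ξ'/|ξ'| and offset 2s/√(1 - s²), which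
is the argument used by `V₁`. -/
lemma preimage_add_sliceHyperplane {ξ : S n} (hξ : horiz (ξ : E (n + 1)) ≠ 0) :
    (fun u => (2 * height (ξ : E (n + 1)) / √(1 - height (ξ : E (n + 1)) ^ 2)) •
        (‖horiz (ξ : E (n + 1))‖⁻¹ • horiz (ξ : E (n + 1))) + u) ⁻¹' sliceHyperplane ξ
      = perp (‖horiz (ξ : E (n + 1))‖⁻¹ • horiz (ξ : E (n + 1))) := by
  have h0 : ‖horiz (ξ : E (n + 1))‖ ≠ 0 := norm_ne_zero_iff.2 hξ
  have hs : √(1 - height (ξ : E (n + 1)) ^ 2) = ‖horiz (ξ : E (n + 1))‖ := by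
    rw [← eq_sub_of_add_eq (norm_horiz_sq_add_height_sq ξ), Real.sqrt_sq (norm_nonneg _)]
  ext u
  simp only [sliceHyperplane, perp, Set.mem_preimage, Set.mem_ofPred_eq, inner_add_right,
    real_inner_smul_left, real_inner_smul_right, real_inner_self_eq_norm_sq, hs]
  have e : 2 * height (ξ : E (n + 1)) / ‖horiz (ξ : E (n + 1))‖ *
      (‖horiz (ξ : E (n + 1))‖⁻¹ * ‖horiz (ξ : E (n + 1))‖ ^ 2) = 2 * height (ξ : E (n + 1)) := by
    field_simp
  rw [e]
  simp [h0]

lemma measurePreserving_const_add (d : ℕ) (v : E n) :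
    MeasurePreserving (fun u => v + u) (μHE[d] : Measure (E n)) μHE[d] :=
  (IsometryEquiv.addLeft v).measurePreserving_euclideanHausdorffMeasure d

lemma radonExists_iff {ξ : S n} (hξ : horiz (ξ : E (n + 1)) ≠ 0) (g : E n → 𝕜) :
    V₁ (RadonExists g) ξ ↔ IntegrableOn g (sliceHyperplane ξ) μHE[n - 1] := by
  rw [V₁, RadonExists, ← preimage_add_sliceHyperplane hξ]
  exact (measurePreserving_const_add (n - 1) _).integrableOn_comp_preimage
    (measurableEmbedding_addLeft _)

lemma radon_eq {ξ : S n} (hξ : horiz (ξ : E (n + 1)) ≠ 0) (g : E n → 𝕜) :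
    V₁ (radon g) ξ = ∫ x in sliceHyperplane ξ, g x ∂μHE[n - 1] := by
  rw [V₁, radon, ← preimage_add_sliceHyperplane hξ]
  exact (measurePreserving_const_add (n - 1) _).setIntegral_preimage_emb
    (measurableEmbedding_addLeft _) g _

/-- No integrability is needed: the Bochner integrals correspond under the change of variables even
when both take the default value 0. -/
lemma sliceTransform_eq {ξ : S n} (hξ : horiz (ξ : E (n + 1)) ≠ 0) (f : S n → 𝕜) :
    sliceTransform f ξ = V₁ (radon (U₁ f)) ξ := by
  rw [radon_eq hξ, sliceTransform, slice_eq_image_stereo,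
    setIntegral_image_stereo _ (measurableSet_sliceHyperplane ξ)]
  rfl

lemma integrableOn_slice_iff (ξ : S n) (f : S n → 𝕜) :
    IntegrableOn f (slice ξ) μHE[n - 1]
      ↔ IntegrableOn (U₁ f) (sliceHyperplane ξ) μHE[n - 1] := by
  rw [slice_eq_image_stereo, integrableOn_image_stereo_iff _ (measurableSet_sliceHyperplane ξ)]
  rfl

end Stereo

/-! ### Integrability on almost every graph hyperplane -/

section AffineGraphs

variable {m : ℕ}

/-- In an orthonormal basis containing u/|u|, the set lies in a box with one side 2R/|u| and the
others 2R. -/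
lemma volume_slab_inter_ball_le (R : ℝ) (hR : 0 ≤ R) (u : E m) (hu : u ≠ 0) (t : ℝ) :
    volume {b : E m | ‖b‖ ≤ R ∧ |inner ℝ b u + t| ≤ R}
      ≤ ENNReal.ofReal ((2 * R) ^ (m - 1) * (2 * R) / ‖u‖) := by
  have hu0 : 0 < ‖u‖ := norm_pos_iff.2 hu
  have hm : Nonempty (Fin m) := by
    by_contra h
    rw [not_nonempty_iff] at h
    exact hu (Subsingleton.elim _ _)
  obtain ⟨i₀⟩ := hm
  obtain ⟨e, he⟩ := Orthonormal.exists_orthonormalBasis_extension_of_card_eq (𝕜 := ℝ) (E := E m)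
    (ι := Fin m) (by simp) (v := fun _ => ‖u‖⁻¹ • u) (s := {i₀}) (by
      refine ⟨fun _ => ?_, fun i j hij => (hij (Subsingleton.elim _ _)).elim⟩
      simp [norm_smul, hu0.ne'])
  have he0 : e i₀ = ‖u‖⁻¹ • u := he i₀ rfl
  let J : Fin m → Set ℝ := fun i =>
    if i = i₀ then Set.Icc ((-R - t) / ‖u‖) ((R - t) / ‖u‖) else Set.Icc (-R) R
  have hmp : MeasurePreserving (fun b : E m => WithLp.ofLp (e.repr b)) volume volume :=
    (PiLp.volume_preserving_ofLp (Fin m)).comp e.measurePreserving_repr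
  have hJ : ∀ i, MeasurableSet (J i) := fun i => by
    simp only [J]
    split_ifs <;> exact measurableSet_Icc
  have hsub : {b : E m | ‖b‖ ≤ R ∧ |inner ℝ b u + t| ≤ R}
      ⊆ (fun b : E m => WithLp.ofLp (e.repr b)) ⁻¹' Set.univ.pi J := by
    rintro b ⟨h1, h2⟩ i -
    simp only [J]
    split_ifs with hi
    · rw [hi, e.repr_apply_apply, he0, real_inner_smul_left, real_inner_comm, inv_mul_eq_div]
      rw [abs_le] at h2
      constructor
      · gcongr; linarith
      · gcongr; linarith
    · rw [Set.mem_Icc, ← abs_le, e.repr_apply_apply]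
      calc |inner ℝ (e i) b| ≤ ‖e i‖ * ‖b‖ := abs_real_inner_le_norm _ _
        _ ≤ R := by simpa using h1
  calc _ ≤ volume ((fun b : E m => WithLp.ofLp (e.repr b)) ⁻¹' Set.univ.pi J) := measure_mono hsub
    _ = ∏ i, volume (J i) := by
      rw [hmp.measure_preimage (MeasurableSet.univ_pi hJ).nullMeasurableSet, volume_pi_pi]
    _ = ENNReal.ofReal (2 * R / ‖u‖) * ∏ i ∈ Finset.univ.erase i₀, ENNReal.ofReal (2 * R) := by
      rw [← Finset.mul_prod_erase _ _ (Finset.mem_univ i₀)]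
      congr 1
      · simp only [J, if_true, Real.volume_Icc]
        congr 1
        ring
      · refine Finset.prod_congr rfl fun i hi => ?_
        simp only [J, if_neg (Finset.ne_of_mem_erase hi), Real.volume_Icc]
        congr 1
        ring
    _ = _ := by
      rw [Finset.prod_const, Finset.card_erase_of_mem (Finset.mem_univ _), Finset.card_univ,
        Fintype.card_fin, ← ENNReal.ofReal_pow (by positivity),
        ← ENNReal.ofReal_mul (by positivity)]
      congr 1
      ring

/-- If the set is nonempty, then |x_{m+1}| ≤ R(1 + |x'|), so |x'| controls |x|. For |x'| ≤ 1 the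
volume of the ball suffices, and otherwise the slab bound does; `D` is chosen so that √(|x|² + 4) ≤
D max(1, |x'|). -/
lemma exists_volume_slab_inter_ball_le (R : ℝ) (hR : 0 ≤ R) :
    ∃ C : ℝ, ∀ x : E (m + 1), volume {b : E m | ‖b‖ ≤ R ∧ |inner ℝ b (horiz x) + height x| ≤ R}
      ≤ ENNReal.ofReal (C * (1 / √(‖x‖ ^ 2 + 4))) := by
  set D : ℝ := √(5 + 4 * R ^ 2) with hD
  set V : ℝ := (volume : Measure (E m)).real (Metric.closedBall 0 R) with hV
  set W : ℝ := (2 * R) ^ (m - 1) * (2 * R) with hW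
  have hV0 : 0 ≤ V := measureReal_nonneg
  have hW0 : 0 ≤ W := by positivity
  refine ⟨(V + W) * D, fun x => ?_⟩
  set A := {b : E m | ‖b‖ ≤ R ∧ |inner ℝ b (horiz x) + height x| ≤ R} with hA
  rcases A.eq_empty_or_nonempty with h | ⟨b, hb1, hb2⟩
  · simp [h]
  have hpos : 0 < √(‖x‖ ^ 2 + 4) := by positivity
  have hheight : |height x| ≤ R + R * ‖horiz x‖ := by
    have h1 : |inner ℝ b (horiz x)| ≤ R * ‖horiz x‖ :=
      (abs_real_inner_le_norm _ _).trans (by gcongr)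
    rw [abs_le] at *
    constructor <;> linarith
  have hsq : height x ^ 2 ≤ (R + R * ‖horiz x‖) ^ 2 := sq_le_sq' (by
    linarith [neg_abs_le (height x)]) (by linarith [le_abs_self (height x)])
  have hxn := norm_sq_eq_horiz_height x
  rcases le_total ‖horiz x‖ 1 with h1 | h1
  · have hle : √(‖x‖ ^ 2 + 4) ≤ D := by
      apply Real.sqrt_le_sqrt
      have h2 : (R + R * ‖horiz x‖) ^ 2 ≤ (R + R * 1) ^ 2 := by gcongr
      have h3 : ‖horiz x‖ ^ 2 ≤ 1 := pow_le_one₀ (norm_nonneg _) h1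
      nlinarith
    calc volume A ≤ volume (Metric.closedBall (0 : E m) R) :=
          measure_mono fun b hb => by simpa using hb.1
      _ = ENNReal.ofReal V := by
          rw [hV, ofReal_measureReal measure_closedBall_lt_top.ne]
      _ ≤ _ := by
          apply ENNReal.ofReal_le_ofReal
          rw [mul_one_div, le_div_iff₀ hpos]
          calc V * √(‖x‖ ^ 2 + 4) ≤ (V + W) * D := by gcongr; linarith
            _ = _ := rfl
  · have hh0 : 0 < ‖horiz x‖ := by linarith
    have hle : √(‖x‖ ^ 2 + 4) ≤ D * ‖horiz x‖ := by
      rw [← Real.sqrt_sq hh0.le, hD, ← Real.sqrt_mul (by positivity)]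
      apply Real.sqrt_le_sqrt
      have h2 : (R + R * ‖horiz x‖) ^ 2 ≤ (R * ‖horiz x‖ + R * ‖horiz x‖) ^ 2 := by
        gcongr
        exact le_mul_of_one_le_right hR h1
      have h3 : 1 ≤ ‖horiz x‖ ^ 2 := one_le_pow₀ h1
      nlinarith
    refine (volume_slab_inter_ball_le R hR (horiz x) (norm_pos_iff.1 hh0) _).trans ?_
    apply ENNReal.ofReal_le_ofReal
    rw [mul_one_div, div_le_div_iff₀ hh0 hpos]
    calc W * √(‖x‖ ^ 2 + 4) ≤ (V + W) * (D * ‖horiz x‖) := by gcongr; linarith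
      _ = _ := by ring

/-- This passes from (hyperplane, base point u) to (slope b, point x of the hyperplane); for fixed b
and u it only translates c. -/
lemma measurePreserving_shear :
    MeasurePreserving (fun p : (E m × ℝ) × E m =>
      (p.1.1, join (p.2, p.1.2 - inner ℝ p.1.1 p.2))) volume volume := by
  have h1 : MeasurePreserving (MeasurableEquiv.prodAssoc : (E m × ℝ) × E m ≃ᵐ E m × ℝ × E m)
      volume volume := volume_preserving_prodAssoc
  have h2 : MeasurePreserving (Prod.map id Prod.swap : E m × (ℝ × E m) → E m × (E m × ℝ))
      volume volume := (MeasurePreserving.id volume).prod Measure.measurePreserving_swap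
  have h3 : MeasurePreserving
      (MeasurableEquiv.prodAssoc : (E m × E m) × ℝ ≃ᵐ E m × (E m × ℝ)).symm volume volume :=
    volume_preserving_prodAssoc.symm
  have h4 : MeasurePreserving (fun p : (E m × E m) × ℝ => (p.1, p.2 - inner ℝ p.1.1 p.1.2))
      volume volume :=
    (MeasurePreserving.id volume).skew_product
      (g := fun (a : E m × E m) (c : ℝ) => c - inner ℝ a.1 a.2)
      (Continuous.measurable (by fun_prop))
      (Filter.Eventually.of_forall fun a => (measurePreserving_sub_right volume _).map_eq)
  have h5 : MeasurePreserving (MeasurableEquiv.prodAssoc : (E m × E m) × ℝ ≃ᵐ E m × (E m × ℝ))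
      volume volume := volume_preserving_prodAssoc
  have h6 : MeasurePreserving (Prod.map id join : E m × (E m × ℝ) → E m × E (m + 1))
      volume volume := (MeasurePreserving.id volume).prod measurePreserving_join
  exact h6.comp (h5.comp (h4.comp (h3.comp (h2.comp h1))))

variable {F : Type*} [NormedAddCommGroup F]

lemma ae_integrable_comp_graph_of_bounded {g : E (m + 1) → F}
    (hgm : AEStronglyMeasurable g volume)
    (hg : ∫⁻ x, ‖g x‖ₑ * ENNReal.ofReal (1 / √(‖x‖ ^ 2 + 4)) < ∞) (R : ℝ) (hR : 0 ≤ R) :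
    ∀ᵐ p : E m × ℝ, ‖p.1‖ ≤ R → |p.2| ≤ R →
      Integrable (fun u : E m => g (join (u, p.2 - inner ℝ p.1 u))) volume := by
  -- The truncation in terms of (b, x): the second condition is |c| ≤ R for the graph of slope b
  -- through x.
  set A : Set (E m × E (m + 1)) :=
    {q | ‖q.1‖ ≤ R ∧ |inner ℝ q.1 (horiz q.2) + height q.2| ≤ R} with hA
  have hh : Continuous (fun q : E m × E (m + 1) => horiz q.2) := continuous_horiz.comp continuous_snd
  have hk : Continuous (fun q : E m × E (m + 1) => height q.2) :=
    continuous_height.comp continuous_snd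
  have hAm : MeasurableSet A :=
    (IsClosed.inter (s₁ := {q : E m × E (m + 1) | ‖q.1‖ ≤ R})
      (s₂ := {q : E m × E (m + 1) | |inner ℝ q.1 (horiz q.2) + height q.2| ≤ R})
      (isClosed_le (by fun_prop) continuous_const)
      (isClosed_le (by fun_prop) continuous_const)).measurableSet
  set H : E m × E (m + 1) → F := A.indicator fun q => g q.2 with hH
  have hHm : AEStronglyMeasurable H (volume.prod volume) := hgm.comp_snd.indicator hAm
  have hHi : Integrable H (volume.prod volume) := by
    refine ⟨hHm, ?_⟩
    obtain ⟨C, hC⟩ := exists_volume_slab_inter_ball_le (m := m) R hR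
    rw [HasFiniteIntegral, lintegral_prod_symm _ hHm.enorm]
    have hC0 : ∀ x : E (m + 1), ∫⁻ b : E m, ‖H (b, x)‖ₑ
        ≤ ENNReal.ofReal C * (‖g x‖ₑ * ENNReal.ofReal (1 / √(‖x‖ ^ 2 + 4))) := fun x => by
      have e : (fun b : E m => ‖H (b, x)‖ₑ)
          = ((fun b : E m => (b, x)) ⁻¹' A).indicator fun _ => ‖g x‖ₑ := by
        funext b
        simp only [hH, Set.indicator, Set.mem_preimage]
        split_ifs <;> simp
      rw [e, lintegral_indicator (measurable_prodMk_right hAm), setLIntegral_const]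
      calc _ ≤ ‖g x‖ₑ * ENNReal.ofReal (C * (1 / √(‖x‖ ^ 2 + 4))) := by
            gcongr
            exact hC x
        _ = _ := by
            rw [ENNReal.ofReal_mul' (by positivity)]
            ring
    calc _ ≤ ∫⁻ x, ENNReal.ofReal C * (‖g x‖ₑ * ENNReal.ofReal (1 / √(‖x‖ ^ 2 + 4))) :=
          lintegral_mono hC0
      _ = ENNReal.ofReal C * ∫⁻ x, ‖g x‖ₑ * ENNReal.ofReal (1 / √(‖x‖ ^ 2 + 4)) :=
          lintegral_const_mul' _ _ ENNReal.ofReal_ne_top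
      _ < ∞ := ENNReal.mul_lt_top ENNReal.ofReal_lt_top hg
  have hcomp : Integrable (fun p : (E m × ℝ) × E m =>
      H (p.1.1, join (p.2, p.1.2 - inner ℝ p.1.1 p.2))) (volume.prod volume) :=
    measurePreserving_shear.integrable_comp_of_integrable hHi
  filter_upwards [hcomp.prod_right_ae] with p hp h1 h2
  refine hp.congr (Filter.Eventually.of_forall fun u => ?_)
  have : (p.1, join (u, p.2 - inner ℝ p.1 u)) ∈ A := by
    simp only [hA, Set.mem_ofPred_eq, horiz_join, height_join, add_sub_cancel]
    exact ⟨h1, h2⟩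
  simp only [hH, Set.indicator_of_mem this]

lemma ae_integrable_comp_graph {g : E (m + 1) → F} (hgm : AEStronglyMeasurable g volume)
    (hg : ∫⁻ x, ‖g x‖ₑ * ENNReal.ofReal (1 / √(‖x‖ ^ 2 + 4)) < ∞) :
    ∀ᵐ p : E m × ℝ, Integrable (fun u : E m => g (join (u, p.2 - inner ℝ p.1 u))) volume := by
  have h : ∀ᵐ p : E m × ℝ, ∀ N : ℕ, ‖p.1‖ ≤ N → |p.2| ≤ N →
      Integrable (fun u : E m => g (join (u, p.2 - inner ℝ p.1 u))) volume :=
    ae_all_iff.2 fun N => ae_integrable_comp_graph_of_bounded hgm hg N N.cast_nonneg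
  filter_upwards [h] with p hp
  obtain ⟨N, hN⟩ := exists_nat_ge (max ‖p.1‖ |p.2|)
  exact hp N ((le_max_left _ _).trans hN) ((le_max_right _ _).trans hN)

/-- The graph of the affine function `u ↦ c - ⟪b, u⟫` over `ℝᵐ`, as a hyperplane of `ℝᵐ⁺¹`. -/
def graphHyperplane (p : E m × ℝ) : Set (E (m + 1)) :=
  {x | inner ℝ p.1 (horiz x) + height x = p.2}

lemma image_graph (p : E m × ℝ) (T : Set (E (m + 1))) :
    T ∩ graphHyperplane p = (fun u => join (u, p.2 - inner ℝ p.1 u)) ''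
      ((fun u => join (u, p.2 - inner ℝ p.1 u)) ⁻¹' T) := by
  rw [Set.image_preimage_eq_inter_range]
  congr 1
  ext x
  constructor
  · intro hx
    refine ⟨horiz x, ?_⟩
    rw [← show _ = p.2 from hx]
    simp
  · rintro ⟨u, rfl⟩
    simp [graphHyperplane]

/-- The graph map is Lipschitz, so surface measure is at most a multiple of the push-forward of
Lebesgue measure. Integrability needs only this inequality, not the Jacobian. -/
lemma integrableOn_graphHyperplane {g : E (m + 1) → F} {p : E m × ℝ}
    (h : Integrable (fun u : E m => g (join (u, p.2 - inner ℝ p.1 u))) volume) :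
    IntegrableOn g (graphHyperplane p) μHE[m] := by
  set L : E m → E (m + 1) := fun u => join (u, p.2 - inner ℝ p.1 u) with hL
  obtain ⟨K, hK⟩ : ∃ K : ℝ≥0, LipschitzWith K L := by
    have h1 : LipschitzWith ‖p.1‖₊ fun u : E m => p.2 - inner ℝ p.1 u := by
      refine LipschitzWith.of_dist_le_mul fun u v => ?_
      rw [Real.dist_eq, dist_comm u v, dist_eq_norm, sub_sub_sub_cancel_left, ← inner_sub_right]
      exact abs_real_inner_le_norm _ _
    exact ⟨_, lipschitzWith_join.comp (LipschitzWith.id.prodMk h1)⟩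
  have hLinj : Function.Injective L := fun u v huv => by
    simpa [hL] using congrArg horiz huv
  have hLm : MeasurableEmbedding L := hK.continuous.measurableEmbedding hLinj
  have hle : (μHE[m] : Measure (E (m + 1))).restrict (graphHyperplane p)
      ≤ ((K : ℝ≥0∞) ^ m) • (volume : Measure (E m)).map L := by
    refine Measure.le_iff.2 fun T hT => ?_
    rw [Measure.restrict_apply hT, image_graph, Measure.smul_apply, hLm.map_apply,
      ← EuclideanSpace.euclideanHausdorffMeasure_eq_volume, Measure.euclideanHausdorffMeasure_def,
      Measure.euclideanHausdorffMeasure_def, Measure.smul_apply, Measure.smul_apply,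
      smul_comm ((K : ℝ≥0∞) ^ m)]
    gcongr
    simpa using hK.hausdorffMeasure_image_le (d := m) (by positivity) (L ⁻¹' T)
  exact ((hLm.integrable_map_iff.2 h).smul_measure (by finiteness)).mono_measure hle

end AffineGraphs

/-! ### From graph parameters to points of the sphere -/

lemma dist_normalize_le {V : Type*} [NormedAddCommGroup V] [InnerProductSpace ℝ V] {v w : V}
    (hv : 1 ≤ ‖v‖) (hw : 1 ≤ ‖w‖) : dist (‖v‖⁻¹ • v) (‖w‖⁻¹ • w) ≤ dist v w := by
  have hv0 : 0 < ‖v‖ := by linarith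
  have hw0 : 0 < ‖w‖ := by linarith
  rw [dist_eq_norm, dist_eq_norm]
  refine (pow_le_pow_iff_left₀ (norm_nonneg _) (norm_nonneg _) two_ne_zero).1 ?_
  have h1 : ‖‖v‖⁻¹ • v - ‖w‖⁻¹ • w‖ ^ 2 = (2 * (‖v‖ * ‖w‖) - 2 * inner ℝ v w) / (‖v‖ * ‖w‖) := by
    rw [norm_sub_sq_real, norm_smul, norm_smul, real_inner_smul_left, real_inner_smul_right,
      norm_inv, norm_inv, norm_norm, norm_norm]
    field_simp
    ring
  have h2 : 0 ≤ 2 * (‖v‖ * ‖w‖) - 2 * inner ℝ v w := by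
    linarith [real_inner_le_norm v w]
  calc _ = (2 * (‖v‖ * ‖w‖) - 2 * inner ℝ v w) / (‖v‖ * ‖w‖) := h1
    _ ≤ 2 * (‖v‖ * ‖w‖) - 2 * inner ℝ v w := div_le_self h2 (one_le_mul_of_one_le_of_one_le hv hw)
    _ ≤ ‖v - w‖ ^ 2 := by
      rw [norm_sub_sq_real]
      nlinarith [sq_nonneg (‖v‖ - ‖w‖)]

section SphereCharts

variable {m : ℕ}

/-- The normal direction in `ℝᵐ⁺²` whose slice corresponds to the graph hyperplane of `p`. -/
def graphNormal (p : E m × ℝ) : E (m + 1 + 1) := join (join (p.1, 1), p.2 / 2)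

lemma one_le_norm_graphNormal (p : E m × ℝ) : 1 ≤ ‖graphNormal p‖ := by
  refine (one_le_sq_iff₀ (norm_nonneg _)).1 ?_
  rw [graphNormal, norm_join_sq, norm_join_sq]
  nlinarith [sq_nonneg ‖p.1‖, sq_nonneg (p.2 / 2)]

lemma dist_graphNormal_le (p q : E m × ℝ) : dist (graphNormal p) (graphNormal q) ≤ 2 * dist p q := by
  have h1 := norm_fst_le (p - q)
  have h2 := norm_snd_le (p - q)
  rw [Prod.fst_sub] at h1
  rw [Prod.snd_sub, Real.norm_eq_abs] at h2
  rw [dist_eq_norm, dist_eq_norm]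
  refine (pow_le_pow_iff_left₀ (norm_nonneg _) (by positivity) two_ne_zero).1 ?_
  rw [graphNormal, graphNormal, join_sub, norm_join_sq, Prod.mk_sub_mk, join_sub, norm_join_sq]
  simp only [Prod.mk_sub_mk, sub_self]
  nlinarith [norm_nonneg (p.1 - q.1), abs_nonneg (p.2 - q.2), sq_abs (p.2 - q.2),
    norm_nonneg (p - q)]

/-- The parametrization of an open hemisphere by graph hyperplanes. -/
def graphChart (p : E m × ℝ) : S (m + 1) :=
  ⟨‖graphNormal p‖⁻¹ • graphNormal p, by
    have h : ‖graphNormal p‖ ≠ 0 := by linarith [one_le_norm_graphNormal p]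
    simp [norm_smul, h]⟩

lemma lipschitzWith_graphChart : LipschitzWith 2 (graphChart : E m × ℝ → S (m + 1)) :=
  LipschitzWith.of_dist_le_mul fun p q =>
    (dist_normalize_le (one_le_norm_graphNormal p) (one_le_norm_graphNormal q)).trans
      (dist_graphNormal_le p q)

lemma lipschitzWith_neg_graphChart :
    LipschitzWith 2 (fun p : E m × ℝ => -graphChart p) :=
  LipschitzWith.of_dist_le_mul fun p q => by
    rw [Subtype.dist_eq, coe_neg_sphere, coe_neg_sphere, dist_neg_neg]
    exact lipschitzWith_graphChart.dist_le_mul p q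

lemma euclideanHausdorffMeasure_image_eq_zero {Y : Type*} [MetricSpace Y] [MeasurableSpace Y]
    [BorelSpace Y] {K : ℝ≥0} {φ : E m × ℝ → Y} (hφ : LipschitzWith K φ) {N : Set (E m × ℝ)}
    (hN : volume N = 0) : μHE[m + 1] (φ '' N) = 0 := by
  have hd : Module.finrank ℝ (E m × ℝ) = m + 1 := by simp
  have h1 : (μH[((m + 1 : ℕ) : ℝ)] : Measure (E m × ℝ)) N = 0 := by
    rw [← hd]
    have : ((volume : Measure (E m)).prod (volume : Measure ℝ)).IsAddHaarMeasure := inferInstance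
    exact Measure.absolutelyContinuous_isAddHaarMeasure _ (volume.prod volume) hN
  have h2 := hφ.hausdorffMeasure_image_le (d := ((m + 1 : ℕ) : ℝ)) (by positivity) N
  rw [h1, mul_zero, nonpos_iff_eq_zero] at h2
  rw [Measure.euclideanHausdorffMeasure_def, Measure.smul_apply, h2, smul_zero]

/-- These are the ξ whose hyperplane is not a graph. Apart from the pole, they are the stereographic
image of a coordinate hyperplane. -/
lemma measure_setOf_height_horiz_eq_zero :
    (μHE[m + 1] : Measure (S (m + 1)))
      {ξ | height (horiz (ξ : E (m + 1 + 1))) = 0} = 0 := by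
  set Z : Set (E (m + 1)) := {x | height x = 0} with hZ
  have hZm : MeasurableSet Z := (isClosed_eq continuous_height continuous_const).measurableSet
  have hsub : {ξ : S (m + 1) | height (horiz (ξ : E (m + 1 + 1))) = 0}
      ⊆ stereo '' Z ∪ {ξ | 1 ≤ height (ξ : E (m + 1 + 1))} := by
    intro ξ hξ
    rcases lt_or_ge (height (ξ : E (m + 1 + 1))) 1 with h | h
    · refine Or.inl ⟨_, ?_, stereo_surjOn h⟩
      have h' : (horiz (ξ : E (m + 1 + 1))) (Fin.last m) = 0 := hξ
      simp [hZ, height, h']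
    · exact Or.inr h
  refine measure_mono_null hsub (measure_union_null ?_ ?_)
  · rw [← Measure.restrict_apply_self, euclideanHausdorffMeasure_restrict_image_stereo _ hZm,
      measurableEmbedding_stereo.map_apply,
      Set.preimage_image_eq _ stereo_injective]
    refine withDensity_absolutelyContinuous _ _ ?_
    rw [Measure.restrict_apply_self, EuclideanSpace.euclideanHausdorffMeasure_eq_volume]
    exact volume_setOf_height_eq_zero
  · have hs : {ξ : S (m + 1) | 1 ≤ height (ξ : E (m + 1 + 1))}.Subsingleton := by
      have key : ∀ ξ : S (m + 1), 1 ≤ height (ξ : E (m + 1 + 1)) →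
          (ξ : E (m + 1 + 1)) = join (0, 1) := by
        intro ξ hξ
        have h1 := norm_horiz_sq_add_height_sq ξ
        have h2 : ‖horiz (ξ : E (m + 1 + 1))‖ ^ 2 = 0 := by
          nlinarith [sq_nonneg ‖horiz (ξ : E (m + 1 + 1))‖]
        have h3 : height (ξ : E (m + 1 + 1)) = 1 := by nlinarith
        have h4 : horiz (ξ : E (m + 1 + 1)) = 0 := by simpa using h2
        rw [← join_horiz_height (ξ : E (m + 1 + 1)), h3, h4]
      exact fun ξ hξ η hη => Subtype.ext ((key ξ hξ).trans (key η hη).symm)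
    have : NullSingletonClass (μH[((m + 1 : ℕ) : ℝ)] : Measure (S (m + 1))) :=
      Measure.nullSingletonClass_hausdorff _ (by positivity)
    rw [Measure.euclideanHausdorffMeasure_def, Measure.smul_apply, hs.measure_zero, smul_zero]

/-- Divide ξ'·x = 2ξ_{n+1} by the last coefficient α of ξ'; the sign of α selects the chart. -/
lemma exists_graphChart {ξ : S (m + 1)} (h : height (horiz (ξ : E (m + 1 + 1))) ≠ 0) :
    ∃ p : E m × ℝ, sliceHyperplane ξ = graphHyperplane p ∧
      (graphChart p = ξ ∨ -graphChart p = ξ) := by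
  set α := height (horiz (ξ : E (m + 1 + 1))) with hα
  set s := height (ξ : E (m + 1 + 1)) with hs
  refine ⟨(α⁻¹ • horiz (horiz (ξ : E (m + 1 + 1))), 2 * s / α), ?_, ?_⟩
  · ext x
    rw [sliceHyperplane, graphHyperplane, Set.mem_ofPred_eq, Set.mem_ofPred_eq,
      inner_eq_horiz_height, ← hα, ← hs, real_inner_smul_left, eq_div_iff h, add_mul,
      mul_comm α⁻¹, inv_mul_cancel_right₀ h, mul_comm α]
  · have hn : graphNormal (α⁻¹ • horiz (horiz (ξ : E (m + 1 + 1))), 2 * s / α)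
        = α⁻¹ • (ξ : E (m + 1 + 1)) := by
      have e1 : ((α⁻¹ • horiz (horiz (ξ : E (m + 1 + 1))), 1) : E m × ℝ)
          = α⁻¹ • (horiz (horiz (ξ : E (m + 1 + 1))), α) := by
        ext <;> simp [h]
      rw [graphNormal, e1, join_smul, hα, join_horiz_height, ← hα]
      have e2 : ((α⁻¹ • horiz (ξ : E (m + 1 + 1)), 2 * s / α / 2) : E (m + 1) × ℝ)
          = α⁻¹ • (horiz (ξ : E (m + 1 + 1)), s) := by
        ext
        · simp
        · simp; ring
      rw [e2, join_smul, hs, join_horiz_height]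
    have hc : (graphChart (α⁻¹ • horiz (horiz (ξ : E (m + 1 + 1))), 2 * s / α) : E (m + 1 + 1))
        = (|α| * α⁻¹) • (ξ : E (m + 1 + 1)) := by
      change ‖graphNormal _‖⁻¹ • graphNormal _ = _
      rw [hn, norm_smul, norm_eq_of_mem_sphere, mul_one, norm_inv, inv_inv, smul_smul,
        Real.norm_eq_abs]
    rcases abs_choice α with h1 | h1
    · left
      apply Subtype.ext
      rw [hc, h1, mul_inv_cancel₀ h, one_smul]
    · right
      apply Subtype.ext
      rw [coe_neg_sphere, hc, h1, neg_mul, mul_inv_cancel₀ h, neg_smul, one_smul, neg_neg]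

/-- A property of hyperplanes that holds for almost all graph hyperplanes holds for the hyperplanes
of almost all points of the sphere. -/
lemma ae_sliceHyperplane {P : Set (E (m + 1)) → Prop}
    (hP : ∀ᵐ p : E m × ℝ, P (graphHyperplane p)) :
    ∀ᵐ ξ : S (m + 1) ∂μHE[m + 1],
      horiz (ξ : E (m + 1 + 1)) ≠ 0 ∧ P (sliceHyperplane ξ) := by
  set N : Set (E m × ℝ) := {p | ¬ P (graphHyperplane p)} with hN
  have hN0 : volume N = 0 := ae_iff.1 hP
  refine ae_iff.2 (measure_mono_null ?_ (measure_union_null measure_setOf_height_horiz_eq_zero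
    (measure_union_null (euclideanHausdorffMeasure_image_eq_zero lipschitzWith_graphChart hN0)
      (euclideanHausdorffMeasure_image_eq_zero lipschitzWith_neg_graphChart hN0))))
  intro ξ hξ
  by_cases h : height (horiz (ξ : E (m + 1 + 1))) = 0
  · exact Or.inl h
  · right
    obtain ⟨p, hp, hpξ⟩ := exists_graphChart h
    have h0 : horiz (ξ : E (m + 1 + 1)) ≠ 0 := fun h0 => h (by rw [h0]; simp [height])
    have hpN : p ∈ N := fun hPp => hξ ⟨h0, hp ▸ hPp⟩
    exact hpξ.imp (fun e => ⟨p, hpN, e⟩) fun e => ⟨p, hpN, e⟩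

end SphereCharts

/-! ### Transfer of measurability and of the weighted norm -/

section Weight

variable {n : ℕ} {𝕜 : Type*} [RCLike 𝕜]

lemma aestronglyMeasurable_U₁ {f : S n → 𝕜} (hf : AEStronglyMeasurable f μHE[n]) :
    AEStronglyMeasurable (U₁ f) volume := by
  have h1 : AEStronglyMeasurable f ((μHE[n] : Measure (S n)).restrict (stereo '' Set.univ)) :=
    hf.mono_measure Measure.restrict_le_self
  rw [euclideanHausdorffMeasure_restrict_image_stereo n MeasurableSet.univ,
    Measure.restrict_univ, EuclideanSpace.euclideanHausdorffMeasure_eq_volume] at h1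
  -- The density ρ^n never vanishes, so Lebesgue measure is absolutely continuous with respect to
  -- the weighted measure.
  have h2 : AEStronglyMeasurable (fun x : E n => f (stereo x)) volume :=
    (h1.comp_measurable measurableEmbedding_stereo.measurable).mono_ac
      (withDensity_absolutelyContinuous'
        (measurable_conformalFactor.pow_const n).coe_nnreal_ennreal.aemeasurable
        (Filter.Eventually.of_forall fun x => by
          simpa using fun h => absurd h (conformalFactor_ne_zero x)))
  refine AEStronglyMeasurable.smul (Continuous.aestronglyMeasurable ?_) h2
  exact (continuous_const.div (by fun_prop) fun x => by positivity).pow _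

lemma lintegral_stereo_le (F : S n → ℝ≥0∞) :
    ∫⁻ x : E n, ((conformalFactor x ^ n : ℝ≥0) : ℝ≥0∞) * F (stereo x) ≤ ∫⁻ η, F η ∂μHE[n] := by
  refine le_trans (le_of_eq ?_) (setLIntegral_le_lintegral (stereo '' Set.univ) F)
  rw [euclideanHausdorffMeasure_restrict_image_stereo n MeasurableSet.univ,
    Measure.restrict_univ, EuclideanSpace.euclideanHausdorffMeasure_eq_volume,
    measurableEmbedding_stereo.lintegral_map,
    lintegral_withDensity_eq_lintegral_mul_non_measurable _
      (measurable_conformalFactor.pow_const n).coe_nnreal_ennreal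
      (Filter.Eventually.of_forall fun x => ENNReal.coe_lt_top)]
  rfl

lemma enorm_U₁_mul_le (hn : n ≠ 0) (f : S n → 𝕜) (x : E n) :
    ‖U₁ f x‖ₑ * ENNReal.ofReal (1 / √(‖x‖ ^ 2 + 4))
      ≤ ((conformalFactor x ^ n : ℝ≥0) : ℝ≥0∞) *
        ENNReal.ofReal (‖f (stereo x)‖ / √(1 - height (stereo x : E (n + 1)))) := by
  have hq : 0 < ‖x‖ ^ 2 + 4 := by positivity
  rw [← ofReal_norm, ← ENNReal.ofReal_coe_nnreal, ← ENNReal.ofReal_mul (by positivity),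
    ← ENNReal.ofReal_mul (by positivity)]
  apply ENNReal.ofReal_le_ofReal
  rw [U₁, norm_smul, NNReal.coe_pow, coe_conformalFactor, one_sub_height_stereo, norm_pow,
    Real.norm_of_nonneg (by positivity)]
  set q := ‖x‖ ^ 2 + 4 with hqd
  -- The factor ρ = 4/q left over from ρ^n = ρ^(n-1)ρ, divided by √(1 - η_{n+1}), equals (4/√8)/√q,
  -- and 4/√8 ≥ 1.
  have hw : 1 / √q ≤ 4 / q * (1 / √(8 / q)) := by
    have hs : 0 < √q := Real.sqrt_pos.2 hq
    have h8 : √8 ≤ 4 := (Real.sqrt_le_iff).2 ⟨by norm_num, by norm_num⟩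
    have h80 : 0 < √(8 : ℝ) := by positivity
    have e : 4 / q * (1 / √(8 / q)) = (4 / √8) * (1 / √q) := by
      rw [Real.sqrt_div (by norm_num)]
      nth_rewrite 1 [← Real.sq_sqrt hq.le]
      field_simp
    rw [e]
    exact le_mul_of_one_le_left (by positivity) ((one_le_div h80).2 h8)
  calc (4 / q) ^ (n - 1) * ‖f (stereo x)‖ * (1 / √q)
      ≤ (4 / q) ^ (n - 1) * ‖f (stereo x)‖ * (4 / q * (1 / √(8 / q))) := by gcongr
    _ = ((4 / q) ^ (n - 1) * (4 / q)) * (‖f (stereo x)‖ / √(8 / q)) := by ring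
    _ = _ := by rw [pow_sub_one_mul hn]

end Weight

end SphericalSlice

end

theorem theorem4p2 {𝕜 : Type*} [RCLike 𝕜] (n : ℕ) (hn : 2 ≤ n) (f : SphericalSlice.S n → 𝕜)
    (hf : AEStronglyMeasurable f μHE[n])
    (hfin : ∫⁻ η : SphericalSlice.S n,
      ENNReal.ofReal (‖f η‖ / √(1 - SphericalSlice.height (η : SphericalSlice.E (n + 1)))) ∂μHE[n]
        < ⊤) :
    ∀ᵐ ξ : SphericalSlice.S n ∂(μHE[n]).restrict (SphericalSlice.upper n),
      IntegrableOn f (SphericalSlice.slice ξ) μHE[n - 1] ∧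
      SphericalSlice.V₁ (SphericalSlice.RadonExists (SphericalSlice.U₁ f)) ξ ∧
      SphericalSlice.sliceTransform f ξ =
        SphericalSlice.V₁ (SphericalSlice.radon (SphericalSlice.U₁ f)) ξ := by
  -- The conclusion holds almost everywhere on the whole sphere.
  refine ae_restrict_of_ae ?_
  obtain ⟨m, rfl⟩ : ∃ m, n = m + 1 := ⟨n - 1, by omega⟩
  have hweight : ∫⁻ x, ‖SphericalSlice.U₁ f x‖ₑ * ENNReal.ofReal (1 / √(‖x‖ ^ 2 + 4)) < ⊤ :=
    ((lintegral_mono fun x => SphericalSlice.enorm_U₁_mul_le m.succ_ne_zero f x).trans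
      (SphericalSlice.lintegral_stereo_le _)).trans_lt hfin
  have hgraph : ∀ᵐ p : SphericalSlice.E m × ℝ,
      IntegrableOn (SphericalSlice.U₁ f) (SphericalSlice.graphHyperplane p) μHE[m] := by
    filter_upwards [SphericalSlice.ae_integrable_comp_graph
      (SphericalSlice.aestronglyMeasurable_U₁ hf) hweight] with p hp
    exact SphericalSlice.integrableOn_graphHyperplane hp
  filter_upwards [SphericalSlice.ae_sliceHyperplane
    (P := fun A => IntegrableOn (SphericalSlice.U₁ f) A μHE[m]) hgraph] with ξ hξ
  exact ⟨(SphericalSlice.integrableOn_slice_iff ξ f).2 hξ.2,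
    (SphericalSlice.radonExists_iff hξ.1 _).2 hξ.2, SphericalSlice.sliceTransform_eq hξ.1 f⟩
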